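/- For a unitary matrix $U\in M_d(\mathbb C)$ with columns $u_0,\dots,u_{d-1}$ let $\mathcal P_U(\rho)=\sum_i\langle u_i|\rho|u_i\rangle\,|i\rangle\langle i|$ be the associated von Neumann measurement, regarded as a measure-and-prepare channel, and let $F_d=\frac1{\sqrt d}\bigl(e^{2\pi i jk/d}\bigr)_{0\le j,k<d}$ be the Fourier matrix. Suppose that one of $\mathcal P_{F_d}$, $\mathcal P_{\mathbb 1}$ (each with probability $1/2$) is applied once to the first subsystem of an input state $\sigma$ on $\mathbb C^d\otimes\mathbb C^k$, and that a binary measurement $\{M,\mathbb 1-M\}$ on the joint output is then used to guess which one it was. The state $\sigma$ discriminates the two measurements perfectly if for some $M$ with $0\le M\le \mathbb 1$ the guess is correct with probability one; $\mathcal P_{F_d}$ and $\mathcal P_{\mathbb 1}$ are perfectly distinguishable if for some $k$ such a state $\sigma$ exists. A state is entangled if it is not separable, that is, not a finite convex combination of product states $\rho\otimes\tau$. Let $d\ge 4$. Then: 1. $\mathcal P_{F_d}$ and $\mathcal P_{\mathbb 1}$ are perfectly distinguishable. 2. There is an entangled pure input state on $\mathbb C^d\otimes\mathbb C^2$, i.e.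 with an ancilla of dimension $2$, which discriminates them perfectly. 3. If $d=m^2n$ with $m,n\in\mathbb N$ and $m>1$, then they can be discriminated perfectly without entanglement: some input state $\rho$ on $\mathbb C^d$ alone, without an ancilla, suffices. 4. If $d$ is prime, then perfect discrimination without entanglement is impossible: no input state on $\mathbb C^d$ alone, and no separable input state on $\mathbb C^d\otimes\mathbb C^k$ for any $k$, discriminates them perfectly. -/

import Mathlib

open scoped ComplexOrder Matrix Kronecker

noncomputable section

namespace QMeas

/-- A quantum state: a positive semidefinite matrix of trace one. -/
def IsState {ι : Type*} [Fintype ι] (ρ : Matrix ι ι ℂ) : Prop :=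
  ρ.PosSemidef ∧ ρ.trace = 1

/-- The rank-one matrix `|ψ⟩⟨ψ|`. -/
def ketbra {ι : Type*} (ψ : ι → ℂ) : Matrix ι ι ℂ :=
  Matrix.vecMulVec ψ (star ψ)

/-- A bipartite state is separable if it is a finite convex combination of product states.
A bipartite state that is not separable is entangled. -/
def IsSeparable {ι κ : Type*} [Fintype ι] [Fintype κ]
    (σ : Matrix (ι × κ) (ι × κ) ℂ) : Prop :=
  ∃ (r : ℕ) (p : Fin r → ℝ) (ρ : Fin r → Matrix ι ι ℂ) (τ : Fin r → Matrix κ κ ℂ),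
    (∀ s, 0 ≤ p s) ∧ ∑ s, p s = 1 ∧ (∀ s, IsState (ρ s)) ∧ (∀ s, IsState (τ s)) ∧
      σ = ∑ s, (p s : ℂ) • (ρ s ⊗ₖ τ s)

/-- The von Neumann measurement `P_U`, as a measure-and-prepare channel
`ρ ↦ ∑ i, ⟨u_i|ρ|u_i⟩ |i⟩⟨i|`, where `u_i` is the `i`-th column of the unitary `U`. -/
def measurement {ι : Type*} [Fintype ι] [DecidableEq ι] (U : Matrix.unitaryGroup ι ℂ) :
    Matrix ι ι ℂ →ₗ[ℂ] Matrix ι ι ℂ where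
  toFun ρ := Matrix.diagonal fun i =>
    star (fun x => (U : Matrix ι ι ℂ) x i) ⬝ᵥ (ρ *ᵥ fun x => (U : Matrix ι ι ℂ) x i)
  map_add' ρ σ := by
    ext i j
    by_cases h : i = j <;> simp [h, Matrix.add_mulVec]
  map_smul' c ρ := by
    ext i j
    by_cases h : i = j <;> simp [h, Matrix.smul_mulVec]

/-- The extension `Φ ⊗ 1` of a linear map by the identity on an ancilla indexed by `κ`:
`Φ` is applied to each block `(⟨·|⊗⟨a|) X (|·⟩⊗|b⟩)`. -/
def withAncilla {ι ι' : Type*} (κ : Type*) (Φ : Matrix ι ι ℂ →ₗ[ℂ] Matrix ι' ι' ℂ)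
    (X : Matrix (ι × κ) (ι × κ) ℂ) : Matrix (ι' × κ) (ι' × κ) ℂ :=
  Matrix.of fun s t => Φ (Matrix.of fun x y => X (x, s.2) (y, t.2)) s.1 t.1

/-- The probability of a correct guess, when one of the states `ρ₀`, `ρ₁` is given with
probability one half each and the binary measurement `{M, 1 - M}` is performed. -/
def successProb {ι : Type*} [Fintype ι] [DecidableEq ι] (ρ₀ ρ₁ M : Matrix ι ι ℂ) : ℝ :=
  1 / 2 * (M * ρ₀).trace.re + 1 / 2 * ((1 - M) * ρ₁).trace.re

/-- Two states are perfectly discriminated by some binary measurement `{M, 1 - M}`. -/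
def PerfectlyDiscriminated {ι : Type*} [Fintype ι] [DecidableEq ι]
    (ρ₀ ρ₁ : Matrix ι ι ℂ) : Prop :=
  ∃ M : Matrix ι ι ℂ, M.PosSemidef ∧ (1 - M).PosSemidef ∧ successProb ρ₀ ρ₁ M = 1

/-- The channels `Φ`, `Ψ` are perfectly discriminated by the bipartite input state `σ`: the
channel acts on the first subsystem, and then the whole output is measured. -/
def DiscriminatedBy {ι ι' κ : Type*} [Fintype ι'] [DecidableEq ι'] [Fintype κ] [DecidableEq κ]
    (Φ Ψ : Matrix ι ι ℂ →ₗ[ℂ] Matrix ι' ι' ℂ) (σ : Matrix (ι × κ) (ι × κ) ℂ) : Prop :=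
  PerfectlyDiscriminated (withAncilla κ Φ σ) (withAncilla κ Ψ σ)

/-- The channels `Φ`, `Ψ` are perfectly distinguishable, with some finite-dimensional ancilla. -/
def PerfectlyDistinguishable {ι ι' : Type*} [Fintype ι] [Fintype ι'] [DecidableEq ι']
    (Φ Ψ : Matrix ι ι ℂ →ₗ[ℂ] Matrix ι' ι' ℂ) : Prop :=
  ∃ (k : ℕ) (σ : Matrix (ι × Fin k) (ι × Fin k) ℂ), IsState σ ∧ DiscriminatedBy Φ Ψ σ

/-- The channels `Φ`, `Ψ` are perfectly distinguishable by an input state of the system alone,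
without an ancilla. -/
def DistinguishableWithoutAncilla {ι ι' : Type*} [Fintype ι] [Fintype ι'] [DecidableEq ι']
    (Φ Ψ : Matrix ι ι ℂ →ₗ[ℂ] Matrix ι' ι' ℂ) : Prop :=
  ∃ ρ : Matrix ι ι ℂ, IsState ρ ∧ PerfectlyDiscriminated (Φ ρ) (Ψ ρ)

/-- The Fourier matrix, with entries `exp(2πi jk/d)/√d` for `0 ≤ j, k < d`. -/
def fourierMatrix (d : ℕ) : Matrix (Fin d) (Fin d) ℂ :=
  Matrix.of fun j k =>
    Complex.exp (2 * Real.pi * Complex.I / d) ^ ((j : ℕ) * (k : ℕ)) / (Real.sqrt d : ℂ)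

theorem fourierMatrix_mem_unitaryGroup (d : ℕ) :
    fourierMatrix d ∈ Matrix.unitaryGroup (Fin d) ℂ := by
  rcases Nat.eq_zero_or_pos d with rfl | hd
  · rw [Matrix.mem_unitaryGroup_iff]
    exact Subsingleton.elim _ _
  have hd0 : d ≠ 0 := hd.ne'
  have hζ := Complex.isPrimitiveRoot_exp d hd0
  rw [Matrix.mem_unitaryGroup_iff]
  ext j k
  have hsq : (Real.sqrt d : ℂ) * (Real.sqrt d : ℂ) = d := by
    rw [← Complex.ofReal_mul, Real.mul_self_sqrt (Nat.cast_nonneg d)]; simp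
  unfold fourierMatrix
  set ζ := Complex.exp (2 * Real.pi * Complex.I / d) with hζd
  have hz0 : ζ ≠ 0 := Complex.exp_ne_zero _
  have hconj : (starRingEnd ℂ) ζ = ζ⁻¹ := by
    rw [hζd, ← Complex.exp_conj, ← Complex.exp_neg]
    congr 1
    simp only [map_div₀, map_mul, map_ofNat, Complex.conj_ofReal, Complex.conj_I, map_natCast]
    ring
  have hterm : ∀ x : Fin d, ζ ^ ((j : ℕ) * (x : ℕ)) / (Real.sqrt d : ℂ) *
      ((starRingEnd ℂ) (ζ ^ ((k : ℕ) * (x : ℕ)) / (Real.sqrt d : ℂ))) =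
      (ζ ^ (j : ℕ) * (ζ ^ (k : ℕ))⁻¹) ^ (x : ℕ) / d := by
    intro x
    rw [map_div₀, map_pow, hconj, Complex.conj_ofReal, div_mul_div_comm, hsq, mul_pow, pow_mul,
      inv_pow, pow_mul, inv_pow]
  simp only [Matrix.mul_apply, Matrix.of_apply, Matrix.star_apply, RCLike.star_def]
  rw [Finset.sum_congr rfl fun x _ => hterm x, ← Finset.sum_div,
    Fin.sum_univ_eq_sum_range (fun x => (ζ ^ (j : ℕ) * (ζ ^ (k : ℕ))⁻¹) ^ x) d]
  by_cases h : j = k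
  · subst h
    have : ζ ^ (j : ℕ) * (ζ ^ (j : ℕ))⁻¹ = 1 := mul_inv_cancel₀ (pow_ne_zero _ hz0)
    simp [this, hd0]
  · have hne : ζ ^ (j : ℕ) * (ζ ^ (k : ℕ))⁻¹ ≠ 1 := by
      intro he
      rw [mul_inv_eq_one₀ (pow_ne_zero _ hz0)] at he
      exact h (Fin.ext (hζ.pow_inj j.2 k.2 he))
    have hp : (ζ ^ (j : ℕ) * (ζ ^ (k : ℕ))⁻¹) ^ d = 1 := by
      rw [mul_pow, inv_pow, ← pow_mul, ← pow_mul, mul_comm (j : ℕ), mul_comm (k : ℕ), pow_mul,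
        pow_mul, hζ.pow_eq_one]
      simp
    rw [geom_sum_eq hne, hp]
    simp [h]

/-- The Fourier matrix as a unitary. -/
def fourier (d : ℕ) : Matrix.unitaryGroup (Fin d) ℂ :=
  ⟨fourierMatrix d, fourierMatrix_mem_unitaryGroup d⟩

end QMeas

end

namespace QMeas

section Trace

variable {n : Type*} [Fintype n]

open scoped MatrixOrder in
theorem _root_.Matrix.PosSemidef.exists_eq_conjTranspose_mul_self {A : Matrix n n ℂ}
    (hA : A.PosSemidef) : ∃ B : Matrix n n ℂ, A = Bᴴ * B := by
  classical
  exact CStarAlgebra.nonneg_iff_eq_star_mul_self.mp hA.nonneg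

theorem trace_mul_eq_trace_conjTranspose_mul_self (B C : Matrix n n ℂ) :
    ((Bᴴ * B) * (Cᴴ * C)).trace = ((B * Cᴴ)ᴴ * (B * Cᴴ)).trace := by
  rw [Matrix.conjTranspose_mul, Matrix.conjTranspose_conjTranspose, ← Matrix.mul_assoc,
    Matrix.trace_mul_comm]
  simp only [Matrix.mul_assoc]

theorem _root_.Matrix.PosSemidef.trace_mul_nonneg {A B : Matrix n n ℂ} (hA : A.PosSemidef)
    (hB : B.PosSemidef) : 0 ≤ (A * B).trace := by
  obtain ⟨C, rfl⟩ := hA.exists_eq_conjTranspose_mul_self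
  obtain ⟨D, rfl⟩ := hB.exists_eq_conjTranspose_mul_self
  rw [trace_mul_eq_trace_conjTranspose_mul_self]
  exact (Matrix.posSemidef_conjTranspose_mul_self _).trace_nonneg

theorem _root_.Matrix.PosSemidef.mul_eq_zero_of_trace_mul_eq_zero {A B : Matrix n n ℂ}
    (hA : A.PosSemidef) (hB : B.PosSemidef) (h : (A * B).trace = 0) : A * B = 0 := by
  obtain ⟨C, rfl⟩ := hA.exists_eq_conjTranspose_mul_self
  obtain ⟨D, rfl⟩ := hB.exists_eq_conjTranspose_mul_self
  rw [trace_mul_eq_trace_conjTranspose_mul_self, Matrix.trace_conjTranspose_mul_self_eq_zero_iff]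
    at h
  rw [Matrix.mul_assoc, ← Matrix.mul_assoc C, h, Matrix.zero_mul, Matrix.mul_zero]

/-- Perfectly discriminated states are orthogonal. -/
theorem PerfectlyDiscriminated.mul_eq_zero [DecidableEq n] {ρ₀ ρ₁ : Matrix n n ℂ}
    (h : PerfectlyDiscriminated ρ₀ ρ₁) (h₀ : IsState ρ₀) (h₁ : IsState ρ₁) : ρ₀ * ρ₁ = 0 := by
  obtain ⟨M, hM, hM', hs⟩ := h
  have e₀ : (M * ρ₀).trace + ((1 - M) * ρ₀).trace = 1 := by
    rw [← Matrix.trace_add, ← Matrix.add_mul, add_sub_cancel, Matrix.one_mul, h₀.2]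
  have e₁ : (M * ρ₁).trace + ((1 - M) * ρ₁).trace = 1 := by
    rw [← Matrix.trace_add, ← Matrix.add_mul, add_sub_cancel, Matrix.one_mul, h₁.2]
  have p₀ := Complex.le_def.1 (hM'.trace_mul_nonneg h₀.1)
  have p₁ := Complex.le_def.1 (hM.trace_mul_nonneg h₁.1)
  have r₀ := congrArg Complex.re e₀
  have r₁ := congrArg Complex.re e₁
  simp only [Complex.add_re, Complex.one_re, Complex.zero_re, Complex.zero_im] at r₀ r₁ p₀ p₁
  unfold successProb at hs
  have z₀ : (ρ₀ * (1 - M)).trace = 0 := by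
    rw [Matrix.trace_mul_comm]
    exact Complex.ext (by rw [Complex.zero_re]; linarith) p₀.2.symm
  have z₁ : (M * ρ₁).trace = 0 := Complex.ext (by rw [Complex.zero_re]; linarith) p₁.2.symm
  have m₀ := h₀.1.mul_eq_zero_of_trace_mul_eq_zero hM' z₀
  have m₁ := hM.mul_eq_zero_of_trace_mul_eq_zero h₁.1 z₁
  calc ρ₀ * ρ₁ = ρ₀ * (1 - M) * ρ₁ + ρ₀ * (M * ρ₁) := by noncomm_ring
    _ = 0 := by rw [m₀, m₁, Matrix.zero_mul, Matrix.mul_zero, add_zero]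

theorem posSemidef_of_isHermitian_of_mul_self {M : Matrix n n ℂ} (h : M.IsHermitian)
    (h' : M * M = M) : M.PosSemidef := by
  have := Matrix.posSemidef_conjTranspose_mul_self M
  rwa [h.eq, h'] at this

theorem isState_ketbra {ψ : n → ℂ} (h : star ψ ⬝ᵥ ψ = 1) : IsState (ketbra ψ) := by
  refine ⟨Matrix.posSemidef_vecMulVec_self_star ψ, ?_⟩
  rw [ketbra, Matrix.trace_vecMulVec, dotProduct_comm, h]

end Trace

section Measurement

variable {ι κ : Type*} [Fintype ι] [DecidableEq ι]

theorem measurement_eq_diagonal (U : Matrix.unitaryGroup ι ℂ) (ρ : Matrix ι ι ℂ) :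
    measurement U ρ = Matrix.diagonal fun i =>
      ((U : Matrix ι ι ℂ)ᴴ * ρ * (U : Matrix ι ι ℂ)) i i := by
  ext i j
  simp only [measurement, LinearMap.coe_mk, AddHom.coe_mk]
  congr 1
  funext i
  rw [Matrix.mul_assoc, Matrix.mul_apply, dotProduct]
  rfl

theorem trace_measurement (U : Matrix.unitaryGroup ι ℂ) (ρ : Matrix ι ι ℂ) :
    (measurement U ρ).trace = ρ.trace := by
  rw [measurement_eq_diagonal, Matrix.trace_diagonal]
  change ((U : Matrix ι ι ℂ)ᴴ * ρ * (U : Matrix ι ι ℂ)).trace = _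
  rw [Matrix.trace_mul_comm, ← Matrix.mul_assoc]
  have : (U : Matrix ι ι ℂ) * (U : Matrix ι ι ℂ)ᴴ = 1 := Matrix.mem_unitaryGroup_iff.1 U.2
  rw [this, Matrix.one_mul]

theorem IsState.measurement {ρ : Matrix ι ι ℂ} (h : IsState ρ) (U : Matrix.unitaryGroup ι ℂ) :
    IsState (measurement U ρ) := by
  refine ⟨?_, by rw [trace_measurement, h.2]⟩
  rw [measurement_eq_diagonal]
  exact Matrix.PosSemidef.diagonal fun i => (h.1.conjTranspose_mul_mul_same _).diag_nonneg

theorem withAncilla_kronecker (U : Matrix.unitaryGroup ι ℂ) (ρ : Matrix ι ι ℂ)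
    (τ : Matrix κ κ ℂ) :
    withAncilla κ (QMeas.measurement U) (ρ ⊗ₖ τ) = QMeas.measurement U ρ ⊗ₖ τ := by
  ext s t
  have : (Matrix.of fun x y => (ρ ⊗ₖ τ) (x, s.2) (y, t.2)) = τ s.2 t.2 • ρ := by
    ext x y
    simp [mul_comm]
  rw [withAncilla, Matrix.of_apply, this, map_smul, Matrix.kroneckerMap_apply, Matrix.smul_apply,
    smul_eq_mul, mul_comm]

theorem withAncilla_sum_smul (U : Matrix.unitaryGroup ι ℂ) {r : ℕ} (p : Fin r → ℂ)
    (σ : Fin r → Matrix (ι × κ) (ι × κ) ℂ) :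
    withAncilla κ (QMeas.measurement U) (∑ s, p s • σ s) =
      ∑ s, p s • withAncilla κ (QMeas.measurement U) (σ s) := by
  ext a b
  have : (Matrix.of fun x y => (∑ s, p s • σ s) (x, a.2) (y, b.2)) =
      ∑ s, p s • Matrix.of fun x y => σ s (x, a.2) (y, b.2) := by
    ext x y
    simp [Matrix.sum_apply]
  rw [withAncilla, Matrix.of_apply, this, map_sum]
  simp only [map_smul, Matrix.sum_apply, Matrix.smul_apply, withAncilla, Matrix.of_apply]

/-- The unnormalized post-measurement vectors of a pure bipartite input. -/
def outcomeVec (U : Matrix.unitaryGroup ι ℂ) (ψ : ι × κ → ℂ) (s : ι × κ) : ℂ :=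
  ∑ x, star ((U : Matrix ι ι ℂ) x s.1) * ψ (x, s.2)

/-- The block diagonal matrix with blocks `|α_i⟩⟨α_i|`. -/
def blockKetbra (α : ι × κ → ℂ) : Matrix (ι × κ) (ι × κ) ℂ :=
  Matrix.of fun s t => if s.1 = t.1 then α s * star (α t) else 0

theorem withAncilla_ketbra (U : Matrix.unitaryGroup ι ℂ) (ψ : ι × κ → ℂ) :
    withAncilla κ (QMeas.measurement U) (ketbra ψ) = blockKetbra (outcomeVec U ψ) := by
  ext s t
  rw [withAncilla, Matrix.of_apply, measurement_eq_diagonal, Matrix.diagonal_apply, blockKetbra,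
    Matrix.of_apply]
  split_ifs with h
  · rw [outcomeVec, outcomeVec, star_sum, Finset.sum_mul_sum, Matrix.mul_assoc, Matrix.mul_apply]
    refine Finset.sum_congr rfl fun x _ => ?_
    rw [Matrix.mul_apply, Finset.mul_sum]
    refine Finset.sum_congr rfl fun y _ => ?_
    simp only [Matrix.conjTranspose_apply, Matrix.of_apply, ketbra, Matrix.vecMulVec_apply,
      Pi.star_apply, star_mul', star_star, h]
    ring
  · rfl

theorem outcomeVec_one (ψ : ι × κ → ℂ) : outcomeVec 1 ψ = ψ := by
  funext s
  simp [outcomeVec, Matrix.one_apply]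

variable [Fintype κ]

theorem trace_withAncilla (U : Matrix.unitaryGroup ι ℂ) (σ : Matrix (ι × κ) (ι × κ) ℂ) :
    (withAncilla κ (QMeas.measurement U) σ).trace = σ.trace := by
  simp only [Matrix.trace, Matrix.diag_apply, withAncilla, Matrix.of_apply]
  rw [Fintype.sum_prod_type_right, Fintype.sum_prod_type_right]
  refine Finset.sum_congr rfl fun a _ => ?_
  exact trace_measurement U (Matrix.of fun x y => σ (x, a) (y, a))

theorem perfectlyDiscriminated_blockKetbra [DecidableEq κ] {α β : ι × κ → ℂ} (hα : (blockKetbra α).trace = 1)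
    (hβ : (blockKetbra β).trace = 1) (h : ∀ i, ∑ a, star (α (i, a)) * β (i, a) = 0) :
    PerfectlyDiscriminated (blockKetbra α) (blockKetbra β) := by
  let N : ι → ℂ := fun i => ∑ a, star (α (i, a)) * α (i, a)
  have hN : ∀ i, star (N i) = N i := fun i => by
    simp only [N, star_sum, star_mul', star_star, mul_comm]
  have hN0 : ∀ i, N i = 0 → ∀ a, α (i, a) = 0 := by
    intro i hi a
    have h1 := (Finset.sum_eq_zero_iff_of_nonneg fun a _ => star_mul_self_nonneg (α (i, a))).1 hi a
      (Finset.mem_univ a)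
    simpa using h1
  let M : Matrix (ι × κ) (ι × κ) ℂ :=
    Matrix.of fun s t => if s.1 = t.1 then α s * star (α t) * (N s.1)⁻¹ else 0
  have hmul : ∀ γ : ι × κ → ℂ, ∀ s t, (M * blockKetbra γ) s t =
      if s.1 = t.1 then α s * (N s.1)⁻¹ * (∑ a, star (α (s.1, a)) * γ (s.1, a)) * star (γ t)
      else 0 := by
    intro γ s t
    rw [Matrix.mul_apply, Fintype.sum_prod_type, Finset.sum_eq_single s.1]
    · simp only [M, blockKetbra, Matrix.of_apply, if_true]
      split_ifs
      · rw [Finset.mul_sum, Finset.sum_mul]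
        exact Finset.sum_congr rfl fun a _ => by ring
      · simp
    · intro i _ hi
      refine Finset.sum_eq_zero fun a _ => ?_
      simp [M, Ne.symm hi]
    · simp
  have hMα : M * blockKetbra α = blockKetbra α := by
    ext s t
    rw [hmul]
    simp only [blockKetbra, Matrix.of_apply]
    split_ifs
    · by_cases h0 : N s.1 = 0
      · rw [show α s = 0 from hN0 _ h0 s.2]
        simp
      · change α s * (N s.1)⁻¹ * N s.1 * star (α t) = _
        rw [inv_mul_cancel_right₀ h0]
    · rfl
  have hMβ : M * blockKetbra β = 0 := by
    ext s t
    rw [hmul, h]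
    simp
  have hMM : M * M = M := by
    have h1 : M = blockKetbra α * Matrix.diagonal fun s => (N s.1)⁻¹ := by
      ext s t
      rw [Matrix.mul_diagonal]
      simp only [M, blockKetbra, Matrix.of_apply]
      split_ifs with hst
      · rw [hst]
      · simp
    calc M * M = M * (blockKetbra α * Matrix.diagonal fun s => (N s.1)⁻¹) := by rw [← h1]
      _ = M := by rw [← Matrix.mul_assoc, hMα, ← h1]
  have hMH : M.IsHermitian := by
    ext s t
    simp only [Matrix.conjTranspose_apply, M, Matrix.of_apply]
    by_cases hst : s.1 = t.1
    · rw [if_pos hst, if_pos hst.symm, star_mul', star_mul', star_star, star_inv₀, hN, hst]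
      ring
    · rw [if_neg hst, if_neg (Ne.symm hst), star_zero]
  refine ⟨M, posSemidef_of_isHermitian_of_mul_self hMH hMM,
    posSemidef_of_isHermitian_of_mul_self (Matrix.isHermitian_one.sub hMH) ?_, ?_⟩
  · rw [Matrix.sub_mul, Matrix.mul_sub, Matrix.mul_sub, hMM]
    simp
  · rw [successProb, Matrix.sub_mul, hMα, hMβ, Matrix.one_mul, sub_zero, hα, hβ]
    norm_num

/-- A pure state discriminates `P_U` and `P_1` perfectly if for each outcome the two
post-measurement vectors of the ancilla are orthogonal. -/
theorem discriminatedBy_ketbra [DecidableEq κ] (U : Matrix.unitaryGroup ι ℂ) {ψ : ι × κ → ℂ}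
    (hψ : star ψ ⬝ᵥ ψ = 1)
    (h : ∀ i, ∑ x, (U : Matrix ι ι ℂ) x i * ∑ a, star (ψ (x, a)) * ψ (i, a) = 0) :
    DiscriminatedBy (QMeas.measurement U) (QMeas.measurement 1) (ketbra ψ) := by
  have ht : ∀ V : Matrix.unitaryGroup ι ℂ, (blockKetbra (outcomeVec V ψ)).trace = 1 := by
    intro V
    rw [← withAncilla_ketbra, trace_withAncilla, (isState_ketbra hψ).2]
  rw [DiscriminatedBy, withAncilla_ketbra, withAncilla_ketbra]
  refine perfectlyDiscriminated_blockKetbra (ht U) (ht 1) fun i => ?_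
  rw [outcomeVec_one, ← h i]
  simp only [outcomeVec, star_sum, star_mul', star_star, Finset.sum_mul, Finset.mul_sum]
  rw [Finset.sum_comm]
  exact Finset.sum_congr rfl fun x _ => Finset.sum_congr rfl fun a _ => by ring

theorem measurement_ketbra (U : Matrix.unitaryGroup ι ℂ) (ψ : ι → ℂ) :
    QMeas.measurement U (ketbra ψ) = Matrix.diagonal fun i =>
      (∑ x, star ((U : Matrix ι ι ℂ) x i) * ψ x) *
        star (∑ x, star ((U : Matrix ι ι ℂ) x i) * ψ x) := by
  rw [measurement_eq_diagonal]
  congr 1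
  funext i
  rw [star_sum, Finset.sum_mul_sum, Matrix.mul_assoc, Matrix.mul_apply]
  refine Finset.sum_congr rfl fun x _ => ?_
  rw [Matrix.mul_apply, Finset.mul_sum]
  refine Finset.sum_congr rfl fun y _ => ?_
  simp only [Matrix.conjTranspose_apply, ketbra, Matrix.vecMulVec_apply, Pi.star_apply, star_mul',
    star_star]
  ring

/-- A vector such that in each basis direction its coefficient with respect to the standard basis
or the one with respect to the columns of `U` vanishes discriminates `P_U` and `P_1`. -/
theorem distinguishableWithoutAncilla_of_ketbra (U : Matrix.unitaryGroup ι ℂ) {ψ : ι → ℂ}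
    (hψ : star ψ ⬝ᵥ ψ = 1)
    (h : ∀ i, ψ i = 0 ∨ ∑ x, star ((U : Matrix ι ι ℂ) x i) * ψ x = 0) :
    DistinguishableWithoutAncilla (QMeas.measurement U) (QMeas.measurement 1) := by
  classical
  refine ⟨ketbra ψ, isState_ketbra hψ, Matrix.diagonal fun i => if ψ i = 0 then 1 else 0,
    Matrix.PosSemidef.diagonal fun i => ?_, ?_, ?_⟩
  · by_cases hi : ψ i = 0 <;> simp [hi]
  · rw [← Matrix.diagonal_one, Matrix.diagonal_sub]
    refine Matrix.PosSemidef.diagonal fun i => ?_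
    by_cases hi : ψ i = 0 <;> simp [hi]
  · have hU : (Matrix.diagonal fun i => if ψ i = 0 then (1 : ℂ) else 0) *
        QMeas.measurement U (ketbra ψ) = QMeas.measurement U (ketbra ψ) := by
      rw [measurement_ketbra, Matrix.diagonal_mul_diagonal]
      congr 1
      funext i
      rcases h i with hi | hi
      · simp [hi]
      · rw [hi]
        simp
    have h1 : (Matrix.diagonal fun i => if ψ i = 0 then (1 : ℂ) else 0) *
        QMeas.measurement 1 (ketbra ψ) = 0 := by
      rw [measurement_ketbra, Matrix.diagonal_mul_diagonal, ← Matrix.diagonal_zero]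
      congr 1
      funext i
      by_cases hi : ψ i = 0 <;> simp [hi, Matrix.one_apply]
    rw [successProb, Matrix.sub_mul, hU, h1, Matrix.one_mul, sub_zero, trace_measurement,
      trace_measurement, (isState_ketbra hψ).2]
    norm_num

/-- A state that discriminates `P_U` and `P_1` without an ancilla yields a nonzero vector
orthogonal, for each `i`, to the `i`-th basis vector or to the `i`-th column of `U`. -/
theorem exists_ne_zero_of_measurement_mul_eq_zero (U : Matrix.unitaryGroup ι ℂ)
    {ρ : Matrix ι ι ℂ} (hρ : IsState ρ)
    (h : QMeas.measurement U ρ * QMeas.measurement 1 ρ = 0) :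
    ∃ v : ι → ℂ, v ≠ 0 ∧ ∀ i, v i = 0 ∨ ∑ x, v x * (U : Matrix ι ι ℂ) x i = 0 := by
  have hρ0 : ρ ≠ 0 := by
    rintro rfl
    simpa using hρ.2
  have hrow : ∃ y, ρ y ≠ 0 := by
    by_contra hcon
    push Not at hcon
    exact hρ0 (funext hcon)
  obtain ⟨y, hy⟩ := hrow
  refine ⟨ρ y, hy, fun i => ?_⟩
  have key : ∀ V : Matrix.unitaryGroup ι ℂ, QMeas.measurement V ρ i i = 0 →
      ∑ x, ρ y x * (V : Matrix ι ι ℂ) x i = 0 := by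
    intro V hV
    have h1 : star (fun x => (V : Matrix ι ι ℂ) x i) ⬝ᵥ
        (ρ *ᵥ fun x => (V : Matrix ι ι ℂ) x i) = 0 := by
      simpa [QMeas.measurement] using hV
    exact congrFun ((hρ.1.dotProduct_mulVec_zero_iff _).1 h1) y
  have h2 := congrFun (congrFun h i) i
  rw [measurement_eq_diagonal U, measurement_eq_diagonal 1, Matrix.diagonal_mul_diagonal,
    Matrix.diagonal_apply_eq, Matrix.zero_apply, mul_eq_zero] at h2
  rcases h2 with h2 | h2
  · right
    refine key U ?_
    rw [measurement_eq_diagonal, Matrix.diagonal_apply_eq, h2]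
  · left
    have := key 1 (by rw [measurement_eq_diagonal, Matrix.diagonal_apply_eq, h2])
    simpa [Matrix.one_apply] using this

/-- If a separable state discriminates `P_U` and `P_1` perfectly, then so does a state without
an ancilla. -/
theorem IsSeparable.exists_measurement_mul_eq_zero [DecidableEq κ] {U : Matrix.unitaryGroup ι ℂ}
    {σ : Matrix (ι × κ) (ι × κ) ℂ} (hσ : IsSeparable σ)
    (h : DiscriminatedBy (QMeas.measurement U) (QMeas.measurement 1) σ) :
    ∃ ρ, IsState ρ ∧ QMeas.measurement U ρ * QMeas.measurement 1 ρ = 0 := by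
  obtain ⟨r, p, ρ, τ, hp, hp1, hρ, hτ, rfl⟩ := hσ
  have hout : ∀ V : Matrix.unitaryGroup ι ℂ,
      withAncilla κ (QMeas.measurement V) (∑ s, (p s : ℂ) • (ρ s ⊗ₖ τ s)) =
        ∑ s, (p s : ℂ) • (QMeas.measurement V (ρ s) ⊗ₖ τ s) := by
    intro V
    rw [withAncilla_sum_smul V (fun s => (p s : ℂ))]
    simp only [withAncilla_kronecker]
  have hst : ∀ V : Matrix.unitaryGroup ι ℂ,
      IsState (∑ s, (p s : ℂ) • (QMeas.measurement V (ρ s) ⊗ₖ τ s)) := by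
    intro V
    constructor
    · refine Matrix.posSemidef_sum _ fun s _ => Matrix.PosSemidef.smul ?_ (by simpa using hp s)
      exact ((hρ s).measurement V).1.kronecker (hτ s).1
    · rw [Matrix.trace_sum]
      simp only [Matrix.trace_smul, Matrix.trace_kronecker, ((hρ _).measurement V).2, (hτ _).2,
        mul_one, smul_eq_mul]
      exact_mod_cast hp1
  rw [DiscriminatedBy, hout, hout] at h
  have h0 := congrArg Matrix.trace (h.mul_eq_zero (hst U) (hst 1))
  obtain ⟨s, -, hs⟩ : ∃ s ∈ Finset.univ, p s ≠ 0 :=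
    Finset.exists_ne_zero_of_sum_ne_zero (by rw [hp1]; exact one_ne_zero)
  rw [Finset.sum_mul_sum, Matrix.trace_sum, Matrix.trace_zero] at h0
  simp only [Matrix.trace_sum, Matrix.smul_mul, Matrix.mul_smul, Matrix.trace_smul,
    ← Matrix.mul_kronecker_mul, Matrix.trace_kronecker, smul_eq_mul] at h0
  have hnn : ∀ a b, 0 ≤ (p b : ℂ) * ((p a : ℂ) *
      ((QMeas.measurement U (ρ a) * QMeas.measurement 1 (ρ b)).trace *
        (τ a * τ b).trace)) := by
    intro a b
    have ha : (0 : ℂ) ≤ p a := by simpa using hp a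
    have hb : (0 : ℂ) ≤ p b := by simpa using hp b
    exact mul_nonneg hb (mul_nonneg ha (mul_nonneg
      (((hρ a).measurement U).1.trace_mul_nonneg ((hρ b).measurement 1).1)
      ((hτ a).1.trace_mul_nonneg (hτ b).1)))
  have h1 := (Finset.sum_eq_zero_iff_of_nonneg
    fun a _ => Finset.sum_nonneg fun b _ => hnn a b).1 h0 s (Finset.mem_univ s)
  have h2 := (Finset.sum_eq_zero_iff_of_nonneg fun b _ => hnn s b).1 h1 s (Finset.mem_univ s)
  have hps : (p s : ℂ) ≠ 0 := by exact_mod_cast hs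
  have hτs : (τ s * τ s).trace ≠ 0 := by
    intro hz
    have h3 : ((τ s)ᴴ * τ s).trace = 0 := by rwa [(hτ s).1.1.eq]
    rw [Matrix.trace_conjTranspose_mul_self_eq_zero_iff] at h3
    have h4 := (hτ s).2
    rw [h3] at h4
    simp at h4
  refine ⟨ρ s, hρ s, ((hρ s).measurement U).1.mul_eq_zero_of_trace_mul_eq_zero
    ((hρ s).measurement 1).1 ?_⟩
  simpa [hps, hτs] using h2

end Measurement

/-- A pure state with a nonvanishing two by two minor of coefficients is entangled. -/
theorem not_isSeparable_ketbra {ι κ : Type*} [Fintype ι] [Fintype κ] {ψ : ι × κ → ℂ} {x y : ι} {a b : κ}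
    (h : ψ (x, a) * ψ (y, b) ≠ ψ (x, b) * ψ (y, a)) : ¬ IsSeparable (ketbra ψ) := by
  rintro ⟨r, p, ρ, τ, hp, -, hρ, hτ, hσ⟩
  let f : Fin 2 → ι := ![x, y]
  let g : Fin 2 → κ := ![a, b]
  have hpsd : (∑ s, (p s : ℂ) • (ρ s ⊗ₖ (τ s)ᵀ)).PosSemidef :=
    Matrix.posSemidef_sum _ fun s _ => Matrix.PosSemidef.smul
      ((hρ s).1.kronecker (hτ s).1.transpose) (by simpa using hp s)
  have hent : ∀ i j c d, (∑ s, (p s : ℂ) • (ρ s ⊗ₖ (τ s)ᵀ)) (i, c) (j, d) =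
      ψ (i, d) * star (ψ (j, c)) := by
    intro i j c d
    have := congrFun (congrFun hσ (i, d)) (j, c)
    rw [ketbra, Matrix.vecMulVec_apply, Pi.star_apply] at this
    rw [this]
    simp [Matrix.sum_apply]
  let e : Fin 2 × Fin 2 → ι × κ := fun s => (f s.1, g s.2)
  let v : Fin 2 × Fin 2 → ℂ := fun s =>
    if s.1 = 0 then -star (ψ (y, g s.2)) else star (ψ (x, g s.2))
  have hv := (hpsd.submatrix e).dotProduct_mulVec_nonneg v
  set Δ := ψ (x, a) * ψ (y, b) - ψ (x, b) * ψ (y, a) with hΔ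
  have hval : star v ⬝ᵥ ((Matrix.submatrix (∑ s, (p s : ℂ) • (ρ s ⊗ₖ (τ s)ᵀ)) e e) *ᵥ v) =
      -2 * (star Δ * Δ) := by
    simp only [dotProduct, Matrix.mulVec, Fintype.sum_prod_type, Fin.sum_univ_two, e,
      Matrix.submatrix_apply, hent, v, f, g, Pi.star_apply]
    simp [hΔ]
    ring
  rw [hval] at hv
  have h1 : 0 ≤ star Δ * Δ := star_mul_self_nonneg Δ
  have h2 : star Δ * Δ = 0 := by
    refine le_antisymm ?_ h1
    have h3 : -2 * (star Δ * Δ) + (star Δ * Δ) ≥ 0 + 0 := add_le_add hv h1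
    have h4 : -2 * (star Δ * Δ) + (star Δ * Δ) = -(star Δ * Δ) := by ring
    rw [h4, add_zero] at h3
    exact neg_nonneg.1 h3
  have h5 : Δ = 0 := by simpa using h2
  exact h (sub_eq_zero.1 h5)

end QMeas

namespace QMeas

open Polynomial in
/-- Over a domain of characteristic `p`, a polynomial of degree less than `p` that is divisible by
`(X - 1) ^ n` and has at most `n` nonzero coefficients vanishes. -/
theorem eq_zero_of_X_sub_one_pow_dvd {F : Type*} [CommRing F] [IsDomain F] (p : ℕ) [CharP F p]
    (N : ℕ) : ∀ (g : F[X]) (n : ℕ), g.natDegree ≤ N → g.natDegree < p →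
      (X - C 1) ^ n ∣ g → g.support.card ≤ n → g = 0 := by
  induction N with
  | zero =>
    intro g n hN _ hdvd hcard
    by_contra hg
    have hn : n ≠ 0 := by
      rintro rfl
      exact hg (by simpa using hcard)
    have h1 := Polynomial.natDegree_le_of_dvd ((dvd_pow_self _ hn).trans hdvd) hg
    rw [natDegree_X_sub_C] at h1
    omega
  | succ N ih =>
    intro g n hN hp hdvd hcard
    by_contra hg
    have hn : n ≠ 0 := by
      rintro rfl
      exact hg (by simpa using hcard)
    by_cases h0 : g.coeff 0 = 0
    · obtain ⟨q, rfl⟩ := X_dvd_iff.2 h0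
      have hq : q ≠ 0 := right_ne_zero_of_mul hg
      have hdeg : (X * q).natDegree = q.natDegree + 1 := natDegree_X_mul hq
      have hcop : IsCoprime ((X - C 1 : F[X]) ^ n) X :=
        IsCoprime.pow_left ⟨-1, 1, by simp⟩
      have hsupp : q.support.card = (X * q).support.card := by
        have : (X * q).support = q.support.map ⟨Nat.succ, Nat.succ_injective⟩ := by
          ext i
          cases i with
          | zero => simp
          | succ i => simp [coeff_X_mul]
        rw [this, Finset.card_map]
      exact hq (ih q n (by omega) (by omega) (hcop.dvd_of_dvd_mul_left hdvd) (by omega))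
    · have hdeg0 : g.natDegree ≠ 0 := by
        intro h
        have h1 := Polynomial.natDegree_le_of_dvd ((dvd_pow_self _ hn).trans hdvd) hg
        rw [natDegree_X_sub_C] at h1
        omega
      have hlt := natDegree_derivative_lt hdeg0
      have hsupp : (derivative g).support.card ≤ n - 1 := by
        have hsub : (derivative g).support.map ⟨Nat.succ, Nat.succ_injective⟩ ⊆
            g.support.erase 0 := by
          intro i hi
          simp only [Finset.mem_map, mem_support_iff, Function.Embedding.coeFn_mk] at hi
          obtain ⟨j, hj, rfl⟩ := hi
          rw [coeff_derivative] at hj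
          simp [left_ne_zero_of_mul hj]
        have h1 := Finset.card_le_card hsub
        rw [Finset.card_map, Finset.card_erase_of_mem (by simpa using h0)] at h1
        omega
      have hd := ih (derivative g) (n - 1) (by omega) (by omega)
        (pow_sub_one_dvd_derivative_of_pow_dvd hdvd) hsupp
      have hc := congrArg (fun f => coeff f (g.natDegree - 1)) hd
      simp only [coeff_derivative, coeff_zero] at hc
      rw [Nat.sub_add_cancel (by omega), mul_eq_zero] at hc
      rcases hc with hc | hc
      · exact hg (leadingCoeff_eq_zero.1 hc)
      · have hcast : ((g.natDegree : ℕ) : F) = 0 := by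
          rw [← hc, ← Nat.cast_succ, Nat.succ_eq_add_one, Nat.sub_add_cancel (by omega)]
        have := Nat.le_of_dvd (by omega) ((CharP.cast_eq_zero_iff F p _).1 hcast)
        omega

/-- A nonzero vector over a domain with well-founded divisibility is a multiple of a vector
with an entry not divisible by a given nonunit. -/
theorem exists_eq_mul_not_dvd {R ι : Type*} [CommRing R] [IsDomain R] [WfDvdMonoid R]
    {π : R} (hπ : ¬ IsUnit π) (w : ι → R) (hw : w ≠ 0) :
    ∃ (c : R) (w' : ι → R), c ≠ 0 ∧ (∀ i, w i = c * w' i) ∧ ∃ j, ¬ π ∣ w' j := by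
  classical
  obtain ⟨i₀, hi₀⟩ := Function.ne_iff.1 hw
  have hfin := FiniteMultiplicity.of_not_isUnit hπ hi₀
  have hex : ∃ n, ∃ j, ¬ π ^ (n + 1) ∣ w j := by
    obtain ⟨n, hn⟩ := hfin
    exact ⟨n, i₀, hn⟩
  obtain ⟨j, hj⟩ := Nat.find_spec hex
  have hall : ∀ i, π ^ (Nat.find hex) ∣ w i := by
    intro i
    rcases hm : Nat.find hex with _ | m
    · simp
    · by_contra h
      exact Nat.find_min hex (m := m) (by omega) ⟨i, h⟩
  choose w' hw' using hall
  refine ⟨π ^ Nat.find hex, w', ?_, hw', j, ?_⟩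
  · intro h0
    exact hi₀ (by rw [hw', h0, zero_mul]; rfl)
  · rintro ⟨t, ht⟩
    exact hj ⟨t, by rw [hw', ht]; ring⟩

open Polynomial in
/-- The principal case of Chebotarev's theorem on roots of unity: for prime `p` the
principal minors of the Fourier matrix do not vanish. -/
theorem eq_zero_of_forall_mem_sum_pow_mul_eq_zero {p : ℕ} (hp : p.Prime) {ω : ℂ}
    (hω : IsPrimitiveRoot ω p) (S : Finset (Fin p)) (v : Fin p → ℂ) (hv : ∀ i ∉ S, v i = 0)
    (h : ∀ i ∈ S, ∑ x : Fin p, ω ^ ((i : ℕ) * (x : ℕ)) * v x = 0) : v = 0 := by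
  classical
  have : Fact p.Prime := ⟨hp⟩
  have : NeZero p := ⟨hp.ne_zero⟩
  have : IsCyclotomicExtension {p} ℚ (CyclotomicField p ℚ) := by
    convert! CyclotomicField.isCyclotomicExtension p ℚ
  let f : CyclotomicField p ℚ →ₐ[ℚ] ℂ := IsAlgClosed.lift
  obtain ⟨z, hz, hfz⟩ : ∃ z : (CyclotomicField p ℚ), IsPrimitiveRoot z p ∧ f z = ω := by
    have h1 := IsCyclotomicExtension.zeta_spec p ℚ (CyclotomicField p ℚ)
    have h2 := h1.map_of_injective (f := f) f.injective
    obtain ⟨a, _, ha⟩ := h2.eq_pow_of_pow_eq_one hω.pow_eq_one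
    have hfa : f (IsCyclotomicExtension.zeta p ℚ (CyclotomicField p ℚ) ^ a) = ω := by rw [map_pow, ha]
    exact ⟨_, IsPrimitiveRoot.of_map_of_injective (f := f) (by rw [hfa]; exact hω) f.injective,
      hfa⟩
  set R := NumberField.RingOfIntegers (CyclotomicField p ℚ)
  let ζ : R := hz.toInteger
  let φ : R →+* ℂ := (f : (CyclotomicField p ℚ) →+* ℂ).comp (algebraMap R (CyclotomicField p ℚ))
  have hφζ : φ ζ = ω := hfz
  have hφ : Function.Injective φ :=
    f.injective.comp (FaithfulSMul.algebraMap_injective R (CyclotomicField p ℚ))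
  have hπ : Prime (ζ - 1) := hz.zeta_sub_one_prime'
  by_contra hv0
  let A : Matrix S S R := Matrix.of fun i x => ζ ^ ((i : ℕ) * (x : ℕ))
  have hdet : A.det = 0 := by
    apply hφ
    rw [map_zero, RingHom.map_det, ← Matrix.exists_mulVec_eq_zero_iff]
    refine ⟨fun x => v x, ?_, ?_⟩
    · intro h0
      apply hv0
      funext i
      by_cases hi : i ∈ S
      · exact congrFun h0 ⟨i, hi⟩
      · exact hv i hi
    · funext i
      rw [Pi.zero_apply, ← h i i.2]
      simp only [Matrix.mulVec, dotProduct, RingHom.mapMatrix_apply, Matrix.map_apply, A,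
        Matrix.of_apply, map_pow, hφζ]
      rw [Finset.sum_coe_sort S (fun x => ω ^ ((i : ℕ) * (x : ℕ)) * v x)]
      exact Finset.sum_subset (Finset.subset_univ _) fun x _ hx => by simp [hv x hx]
  obtain ⟨w₀, hw₀, hAw₀⟩ := Matrix.exists_mulVec_eq_zero_iff.2 hdet
  obtain ⟨c, w, hc, hcw, j, hj⟩ := exists_eq_mul_not_dvd hπ.not_isUnit w₀ hw₀
  have hAw : ∀ i : S, ∑ x : S, ζ ^ ((i : ℕ) * (x : ℕ)) * w x = 0 := by
    intro i
    have h1 := congrFun hAw₀ i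
    simp only [Matrix.mulVec, dotProduct, A, Matrix.of_apply, Pi.zero_apply, hcw] at h1
    have h2 : c * ∑ x : S, ζ ^ ((i : ℕ) * (x : ℕ)) * w x = 0 := by
      rw [← h1, Finset.mul_sum]
      exact Finset.sum_congr rfl fun x _ => by ring
    exact (mul_eq_zero.1 h2).resolve_left hc
  let g : R[X] := ∑ x : S, C (w x) * X ^ (x : ℕ)
  have hcoeff : ∀ x : S, g.coeff (x : ℕ) = w x := by
    intro x
    simp only [g, finsetSum_coeff, coeff_C_mul_X_pow]
    rw [Finset.sum_eq_single x]
    · simp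
    · intro y _ hy
      rw [if_neg]
      intro he
      exact hy (Subtype.ext (Fin.ext he.symm))
    · simp
  have hg0 : g ≠ 0 := by
    intro h0
    apply hj
    rw [← hcoeff j, h0]
    simp
  have hsuppg : g.support ⊆ S.map Fin.valEmbedding := by
    intro m hm
    by_contra hmS
    rw [mem_support_iff] at hm
    apply hm
    simp only [g, finsetSum_coeff, coeff_C_mul_X_pow]
    refine Finset.sum_eq_zero fun x _ => ?_
    rw [if_neg]
    rintro rfl
    exact hmS (Finset.mem_map.2 ⟨x, x.2, rfl⟩)
  have hdegg : g.natDegree < p := by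
    have := hsuppg (natDegree_mem_support_of_nonzero hg0)
    obtain ⟨x, _, hx⟩ := Finset.mem_map.1 this
    rw [← hx]
    exact x.2
  have hroot : ((S.val.map fun i : Fin p => ζ ^ (i : ℕ)).map fun a => X - C a).prod ∣ g := by
    rw [Multiset.prod_X_sub_C_dvd_iff_le_roots hg0, Multiset.le_iff_subset]
    · intro a ha
      obtain ⟨i, hi, rfl⟩ := Multiset.mem_map.1 ha
      rw [mem_roots hg0, IsRoot.def]
      simp only [g, eval_finsetSum, eval_mul, eval_C, eval_pow, eval_X]
      rw [← hAw ⟨i, hi⟩]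
      exact Finset.sum_congr rfl fun x _ => by rw [pow_mul]; ring
    · refine Multiset.Nodup.map ?_ S.nodup
      intro a b hab
      exact Fin.ext (hz.toInteger_isPrimitiveRoot.pow_inj a.2 b.2 hab)
  let I : Ideal R := Ideal.span {ζ - 1}
  have : I.IsPrime := (Ideal.span_singleton_prime hπ.ne_zero).2 hπ
  let q : R →+* R ⧸ I := Ideal.Quotient.mk I
  have hqζ : q ζ = 1 := by
    rw [← sub_eq_zero, ← map_one q, ← map_sub]
    exact Ideal.Quotient.eq_zero_iff_mem.2 (Ideal.mem_span_singleton_self _)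
  have : CharP (R ⧸ I) p := by
    have h0 : ((p : ℕ) : R ⧸ I) = 0 := by
      rw [← map_natCast q]
      exact Ideal.Quotient.eq_zero_iff_mem.2
        (Ideal.mem_span_singleton.2 hz.toInteger_sub_one_dvd_prime')
    exact (CharP.charP_iff_prime_eq_zero hp).2 h0
  have hdvd : (X - C 1 : (R ⧸ I)[X]) ^ S.card ∣ g.map q := by
    have h1 := Polynomial.map_dvd q hroot
    rw [Polynomial.map_multiset_prod, Multiset.map_map, Multiset.map_map] at h1
    have h2 : ∀ i ∈ S.val, ((Polynomial.map q ∘ fun a => X - C a) ∘ fun i : Fin p => ζ ^ (i : ℕ)) i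
        = (X - C 1 : (R ⧸ I)[X]) := by
      intro i _
      simp [hqζ]
    rw [Multiset.map_congr rfl h2, Multiset.map_const', Multiset.prod_replicate] at h1
    exact h1
  have hzero := eq_zero_of_X_sub_one_pow_dvd p _ (g.map q) S.card le_rfl
    (natDegree_map_le.trans_lt hdegg) hdvd
    ((Finset.card_le_card ((support_map_subset q g).trans hsuppg)).trans (by simp))
  apply hj
  have := congrArg (fun f => coeff f (j : ℕ)) hzero
  simp only [coeff_map, hcoeff, coeff_zero] at this
  exact Ideal.mem_span_singleton.1 (Ideal.Quotient.eq_zero_iff_mem.1 this)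

end QMeas

namespace QMeas

theorem exists_smul_dotProduct_eq_one {n : Type*} [Fintype n] {ψ : n → ℂ} (hψ : ψ ≠ 0) :
    ∃ c : ℂ, c ≠ 0 ∧ star (c • ψ) ⬝ᵥ (c • ψ) = 1 := by
  have hsum : star ψ ⬝ᵥ ψ = ((∑ i, Complex.normSq (ψ i) : ℝ) : ℂ) := by
    rw [dotProduct, Complex.ofReal_sum]
    exact Finset.sum_congr rfl fun i _ => (Complex.normSq_eq_conj_mul_self).symm
  set N := ∑ i, Complex.normSq (ψ i) with hN
  have hN0 : 0 ≤ N := Finset.sum_nonneg fun i _ => Complex.normSq_nonneg _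
  have hne : N ≠ 0 := by
    intro h
    rw [h, Complex.ofReal_zero] at hsum
    exact hψ (dotProduct_star_self_eq_zero.1 hsum)
  have hsq : (Real.sqrt N : ℂ) * Real.sqrt N = N := by
    rw [← Complex.ofReal_mul, Real.mul_self_sqrt hN0]
  have hs0 : (Real.sqrt N : ℂ) ≠ 0 := by
    intro h
    rw [h, zero_mul] at hsq
    exact hne (by exact_mod_cast hsq.symm)
  refine ⟨(Real.sqrt N : ℂ)⁻¹, inv_ne_zero hs0, ?_⟩
  rw [star_smul, smul_dotProduct, dotProduct_smul, hsum, smul_eq_mul, smul_eq_mul, star_inv₀,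
    RCLike.star_def, Complex.conj_ofReal, ← hsq]
  field_simp

/-- The standard primitive `d`-th root of unity. -/
noncomputable def rootOfUnity (d : ℕ) : ℂ := Complex.exp (2 * Real.pi * Complex.I / d)

theorem isPrimitiveRoot_rootOfUnity {d : ℕ} (hd : d ≠ 0) : IsPrimitiveRoot (rootOfUnity d) d :=
  Complex.isPrimitiveRoot_exp d hd

theorem fourier_apply (d : ℕ) (x i : Fin d) : (fourier d : Matrix (Fin d) (Fin d) ℂ) x i =
    rootOfUnity d ^ ((x : ℕ) * (i : ℕ)) / (Real.sqrt d : ℂ) := rfl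

theorem sqrt_natCast_ne_zero {d : ℕ} (hd : d ≠ 0) : (Real.sqrt d : ℂ) ≠ 0 := by
  have : 0 < Real.sqrt d := Real.sqrt_pos.2 (by exact_mod_cast Nat.pos_of_ne_zero hd)
  exact_mod_cast this.ne'

/-- A vector over `ℤ/d` for prime `d` does not have a support disjoint from that of its Fourier
transform. -/
theorem eq_zero_of_eq_zero_or_sum_fourier_eq_zero {d : ℕ} (hd : d.Prime) (v : Fin d → ℂ)
    (h : ∀ i, v i = 0 ∨ ∑ x, v x * (fourier d : Matrix (Fin d) (Fin d) ℂ) x i = 0) : v = 0 := by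
  classical
  refine eq_zero_of_forall_mem_sum_pow_mul_eq_zero hd (isPrimitiveRoot_rootOfUnity hd.ne_zero)
    (Finset.univ.filter fun i => v i ≠ 0) v (fun i hi => by simpa using hi) fun i hi => ?_
  have h1 := (h i).resolve_left (by simpa using hi)
  have h2 : ∑ x, v x * (fourier d : Matrix (Fin d) (Fin d) ℂ) x i =
      (∑ x : Fin d, rootOfUnity d ^ ((i : ℕ) * (x : ℕ)) * v x) / (Real.sqrt d : ℂ) := by
    rw [Finset.sum_div]
    refine Finset.sum_congr rfl fun x _ => ?_
    rw [fourier_apply, mul_comm (i : ℕ)]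
    ring
  rw [h2, div_eq_zero_iff] at h1
  exact h1.resolve_right (sqrt_natCast_ne_zero hd.ne_zero)

/-- If `d` has a square factor, then a modulated indicator of a subgroup of `ℤ/d` discriminates
the Fourier measurement from the computational one. -/
theorem distinguishableWithoutAncilla_fourier {d m n : ℕ} (hd0 : d ≠ 0) (hm : 1 < m)
    (hd : d = m ^ 2 * n) :
    DistinguishableWithoutAncilla (measurement (fourier d)) (measurement 1) := by
  have hω := isPrimitiveRoot_rootOfUnity hd0
  have hdm : d = m * n * m := by rw [hd]; ring
  have hmn : 0 < m * n := Nat.pos_of_ne_zero fun h => hd0 (by rw [hdm, h, zero_mul])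
  have hωm : IsPrimitiveRoot (rootOfUnity d ^ (m * n)) m := hω.pow (Nat.pos_of_ne_zero hd0) hdm
  let ψ : Fin d → ℂ := fun x => if m * n ∣ (x : ℕ) then rootOfUnity d ^ (x : ℕ) else 0
  have hψ : ψ ≠ 0 := by
    intro h
    have := congrFun h ⟨0, Nat.pos_of_ne_zero hd0⟩
    simp [ψ] at this
  have hcond : ∀ i, ψ i = 0 ∨
      ∑ x, star ((fourier d : Matrix (Fin d) (Fin d) ℂ) x i) * ψ x = 0 := by
    intro i
    by_cases hi : m * n ∣ (i : ℕ)
    · right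
      have hterm : ∀ x : Fin d, star ((fourier d : Matrix (Fin d) (Fin d) ℂ) x i) * ψ x =
          (if m * n ∣ (x : ℕ) then rootOfUnity d ^ (x : ℕ) else 0) / (Real.sqrt d : ℂ) := by
        intro x
        simp only [ψ]
        split_ifs with hx
        · have hdvd : d ∣ (x : ℕ) * (i : ℕ) := by
            refine dvd_trans ?_ (mul_dvd_mul hx hi)
            rw [hdm]
            exact mul_dvd_mul_left _ (dvd_mul_right m n)
          rw [fourier_apply, (hω.pow_eq_one_iff_dvd _).2 hdvd, RCLike.star_def, map_div₀, map_one,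
            Complex.conj_ofReal]
          ring
        · simp
      rw [Finset.sum_congr rfl fun x _ => hterm x, ← Finset.sum_div,
        Fin.sum_univ_eq_sum_range (fun x => if m * n ∣ x then rootOfUnity d ^ x else 0) d,
        ← Finset.sum_filter]
      have himg : (Finset.range d).filter (fun x => m * n ∣ x) =
          (Finset.range m).image fun t => m * n * t := by
        ext x
        simp only [Finset.mem_filter, Finset.mem_range, Finset.mem_image]
        constructor
        · rintro ⟨hx, t, rfl⟩
          exact ⟨t, lt_of_mul_lt_mul_left (hx.trans_eq hdm) hmn.le, rfl⟩
        · rintro ⟨t, ht, rfl⟩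
          exact ⟨(Nat.mul_lt_mul_of_pos_left ht hmn).trans_eq hdm.symm, dvd_mul_right _ _⟩
      rw [himg, Finset.sum_image fun a _ b _ hab => Nat.eq_of_mul_eq_mul_left hmn hab]
      simp only [pow_mul _ (m * n)]
      rw [hωm.geom_sum_eq_zero hm, zero_div]
    · left
      simp [ψ, hi]
  obtain ⟨c, -, hc⟩ := exists_smul_dotProduct_eq_one hψ
  refine distinguishableWithoutAncilla_of_ketbra _ hc fun i => (hcond i).imp ?_ ?_
  · intro h
    simp [h]
  · intro h
    simp only [Pi.smul_apply, smul_eq_mul]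
    rw [← mul_zero c, ← h, Finset.mul_sum]
    exact Finset.sum_congr rfl fun x _ => by ring

/-- A family of four vectors of the ancilla, attached to the first four basis vectors, yields an
entangled input state that discriminates the Fourier measurement from the computational one. -/
theorem exists_entangled_of_family {d : ℕ} (hd : 4 ≤ d) (φ : ℕ → Fin 2 → ℂ)
    (hφ : ∀ n, 4 ≤ n → φ n = 0)
    (hsum : ∀ i < 4, ∑ x ∈ Finset.range 4,
      rootOfUnity d ^ (x * i) * ∑ a, star (φ x a) * φ i a = 0)
    (hdet : φ 0 0 * φ 3 1 ≠ φ 0 1 * φ 3 0) :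
    ∃ ψ : Fin d × Fin 2 → ℂ, star ψ ⬝ᵥ ψ = 1 ∧ ¬ IsSeparable (ketbra ψ) ∧
      DiscriminatedBy (measurement (fourier d)) (measurement 1) (ketbra ψ) := by
  let ψ : Fin d × Fin 2 → ℂ := fun s => φ s.1 s.2
  have hψdet : ψ (⟨0, by omega⟩, 0) * ψ (⟨3, by omega⟩, 1) ≠
      ψ (⟨0, by omega⟩, 1) * ψ (⟨3, by omega⟩, 0) := hdet
  have hψ : ψ ≠ 0 := by
    intro h
    rw [h] at hψdet
    simp at hψdet
  have hcond : ∀ i : Fin d, ∑ x, (fourier d : Matrix (Fin d) (Fin d) ℂ) x i *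
      ∑ a, star (ψ (x, a)) * ψ (i, a) = 0 := by
    intro i
    by_cases hi : (i : ℕ) < 4
    · have hterm : ∀ x : Fin d, (fourier d : Matrix (Fin d) (Fin d) ℂ) x i *
          ∑ a, star (ψ (x, a)) * ψ (i, a) =
          (rootOfUnity d ^ ((x : ℕ) * i) * ∑ a, star (φ x a) * φ i a) / (Real.sqrt d : ℂ) := by
        intro x
        rw [fourier_apply]
        ring
      rw [Finset.sum_congr rfl fun x _ => hterm x, ← Finset.sum_div, Fin.sum_univ_eq_sum_range
        (fun x : ℕ => rootOfUnity d ^ (x * (i : ℕ)) * ∑ a, star (φ x a) * φ i a) d,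
        ← Finset.sum_subset (Finset.range_subset_range.2 hd), hsum i hi, zero_div]
      intro x _ hx
      rw [hφ x (by simpa using hx)]
      simp
    · refine Finset.sum_eq_zero fun x _ => ?_
      simp only [ψ]
      rw [hφ i (by omega)]
      simp
  obtain ⟨c, hc0, hc⟩ := exists_smul_dotProduct_eq_one hψ
  refine ⟨c • ψ, hc, not_isSeparable_ketbra (x := ⟨0, by omega⟩) (y := ⟨3, by omega⟩) (a := 0)
    (b := 1) ?_, discriminatedBy_ketbra _ hc fun i => ?_⟩
  · simp only [Pi.smul_apply, smul_eq_mul]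
    intro h
    apply hψdet
    apply mul_left_cancel₀ (mul_ne_zero hc0 hc0)
    linear_combination h
  · rw [← mul_zero (star c * c), ← hcond i, Finset.mul_sum]
    refine Finset.sum_congr rfl fun x _ => ?_
    simp only [Pi.smul_apply, smul_eq_mul, star_mul', Finset.mul_sum]
    exact Finset.sum_congr rfl fun a _ => by ring

theorem exists_entangled_four :
    ∃ ψ : Fin 4 × Fin 2 → ℂ, star ψ ⬝ᵥ ψ = 1 ∧ ¬ IsSeparable (ketbra ψ) ∧
      DiscriminatedBy (measurement (fourier 4)) (measurement 1) (ketbra ψ) := by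
  have hω : rootOfUnity 4 = Complex.I := by
    have h : (2 * Real.pi * Complex.I / (4 : ℕ) : ℂ) = Real.pi / 2 * Complex.I := by
      push_cast
      ring
    rw [rootOfUnity, h, Complex.exp_pi_div_two_mul_I]
  refine exists_entangled_of_family le_rfl
    (fun n => match n with
      | 0 => ![1, 0]
      | 1 => ![0, 1]
      | 2 => ![-1, 0]
      | 3 => ![0, 1]
      | _ => 0) ?_ ?_ ?_
  · intro n hn
    match n, hn with
    | n + 4, _ => rfl
  · intro i hi
    have h3 : Complex.I ^ 3 = -Complex.I := Complex.I_pow_three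
    have h9 : Complex.I ^ 9 = Complex.I := by
      rw [show 9 = 4 * 2 + 1 from rfl, pow_succ, pow_mul, Complex.I_pow_four]
      simp
    interval_cases i <;> simp [hω, Finset.sum_range_succ, h3, h9]
  · simp

/-- The real and imaginary parts of the two orthogonality relations of a reflection-symmetric
pair of vectors can be solved. -/
theorem exists_symmetric_solution {c₀ c₁ c₂ s₀ s₁ s₂ : ℝ} (hc₀ : 0 < c₀) (hc₁ : 0 < c₁)
    (hs₀ : 0 < s₀) (hs₁ : 0 < s₁) (hs₂ : 0 < s₂) (hD : 0 < c₁ ^ 2 - c₀ * c₂)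
    (hR : 0 < s₁ ^ 2 - s₀ * s₂) :
    ∃ (y ν a b : ℝ), ν ≠ 0 ∧ c₂ + y * c₁ + b * ν * s₁ = 0 ∧ ν * s₂ + a * s₁ = 0 ∧
      y ^ 2 * c₀ + y * c₁ - b * ν * s₁ = 0 ∧ (a ^ 2 + b ^ 2) * s₀ + a * ν * s₁ = 0 := by
  set D := Real.sqrt (c₁ ^ 2 - c₀ * c₂) with hDdef
  have hDpos : 0 < D := Real.sqrt_pos.2 hD
  have hDsq : D ^ 2 = c₁ ^ 2 - c₀ * c₂ := Real.sq_sqrt hD.le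
  set y := -(c₁ + D) / c₀ with hy
  have hyc : y * c₀ = -(c₁ + D) := by rw [hy]; field_simp
  have hyneg : y < 0 := div_neg_of_neg_of_pos (by linarith) hc₀
  set k := -y * D / s₁ with hk
  have hkpos : 0 < k := div_pos (mul_pos (neg_pos.2 hyneg) hDpos) hs₁
  have hks : k * s₁ = -y * D := by rw [hk]; field_simp
  set q := Real.sqrt (s₀ * s₂ / (s₁ ^ 2 - s₀ * s₂)) with hq
  have hq0 : 0 < s₀ * s₂ / (s₁ ^ 2 - s₀ * s₂) := div_pos (mul_pos hs₀ hs₂) hR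
  have hqpos : 0 < q := Real.sqrt_pos.2 hq0
  have hqsq : q ^ 2 * (s₁ ^ 2 - s₀ * s₂) = s₀ * s₂ := by
    rw [hq, Real.sq_sqrt hq0.le, div_mul_cancel₀ _ hR.ne']
  have hN : 0 < k * s₁ * q / s₂ := by positivity
  set ν := Real.sqrt (k * s₁ * q / s₂) with hν
  have hνpos : 0 < ν := Real.sqrt_pos.2 hN
  have hνsq : ν ^ 2 * s₂ = k * s₁ * q := by rw [hν, Real.sq_sqrt hN.le, div_mul_cancel₀ _ hs₂.ne']
  have hb : k / ν * ν = k := div_mul_cancel₀ _ hνpos.ne'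
  have ha : -(ν * s₂ / s₁) * s₁ = -(ν * s₂) := by field_simp
  refine ⟨y, ν, -(ν * s₂ / s₁), k / ν, hνpos.ne', ?_, ?_, ?_, ?_⟩
  · rw [hb, hks]
    apply mul_left_cancel₀ hc₀.ne'
    linear_combination (c₁ - D) * hyc + hDsq
  · rw [ha]; ring
  · rw [hb, hks]
    linear_combination y * hyc
  · have key : (ν ^ 2 * s₂) ^ 2 * (s₁ ^ 2 - s₀ * s₂) = k ^ 2 * s₁ ^ 2 * (s₀ * s₂) := by
      rw [hνsq]
      linear_combination k ^ 2 * s₁ ^ 2 * hqsq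
    have h1 : ((-(ν * s₂ / s₁)) ^ 2 + (k / ν) ^ 2) * s₀ + -(ν * s₂ / s₁) * ν * s₁ =
        (k ^ 2 * s₁ ^ 2 * (s₀ * s₂) - (ν ^ 2 * s₂) ^ 2 * (s₁ ^ 2 - s₀ * s₂)) /
          (ν ^ 2 * s₁ ^ 2 * s₂) := by
      field_simp
      ring
    rw [h1, key, sub_self, zero_div]

theorem exists_entangled_of_five_le {d : ℕ} (hd : 5 ≤ d) :
    ∃ ψ : Fin d × Fin 2 → ℂ, star ψ ⬝ᵥ ψ = 1 ∧ ¬ IsSeparable (ketbra ψ) ∧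
      DiscriminatedBy (measurement (fourier d)) (measurement 1) (ketbra ψ) := by
  set α : ℝ := Real.pi / (2 * d) with hα
  have hd' : (5 : ℝ) ≤ d := by exact_mod_cast hd
  have hπ := Real.pi_pos
  have hαpos : 0 < α := by positivity
  have hα10 : 10 * α ≤ Real.pi := by
    rw [hα, mul_div_assoc', div_le_iff₀ (by positivity)]
    nlinarith
  have hs₀ : 0 < Real.sin α := Real.sin_pos_of_pos_of_lt_pi hαpos (by linarith)
  have hs₁ : 0 < Real.sin (3 * α) := Real.sin_pos_of_pos_of_lt_pi (by linarith) (by linarith)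
  have hs₂ : 0 < Real.sin (9 * α) := Real.sin_pos_of_pos_of_lt_pi (by linarith) (by linarith)
  have hc₀ : 0 < Real.cos α := Real.cos_pos_of_mem_Ioo ⟨by linarith, by linarith⟩
  have hc₁ : 0 < Real.cos (3 * α) := Real.cos_pos_of_mem_Ioo ⟨by linarith, by linarith⟩
  have hsc := Real.sin_sq_add_cos_sq α
  have e₁ := Real.cos_three_mul α
  have f₁ := Real.sin_three_mul α
  have e₂ : Real.cos (9 * α) = 4 * Real.cos (3 * α) ^ 3 - 3 * Real.cos (3 * α) := by
    rw [← Real.cos_three_mul]; ring_nf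
  have f₂ : Real.sin (9 * α) = 3 * Real.sin (3 * α) - 4 * Real.sin (3 * α) ^ 3 := by
    rw [← Real.sin_three_mul]; ring_nf
  have hw : 0 < 4 * Real.cos α ^ 2 - 3 := by
    have : Real.cos (3 * α) = Real.cos α * (4 * Real.cos α ^ 2 - 3) := by rw [e₁]; ring
    exact pos_of_mul_pos_right (this ▸ hc₁) hc₀.le
  have hs2 : 0 < Real.sin α ^ 2 := by positivity
  have hD : 0 < Real.cos (3 * α) ^ 2 - Real.cos α * Real.cos (9 * α) := by
    have : Real.cos (3 * α) ^ 2 - Real.cos α * Real.cos (9 * α) =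
        32 * (Real.cos α ^ 2) ^ 2 * (4 * Real.cos α ^ 2 - 3) * (1 - Real.cos α ^ 2) *
          (2 * Real.cos α ^ 2 - 1) := by
      rw [e₂, e₁]; ring
    rw [this]
    have h1 : 0 < 1 - Real.cos α ^ 2 := by linarith
    have h2 : 0 < 2 * Real.cos α ^ 2 - 1 := by linarith
    positivity
  have hR : 0 < Real.sin (3 * α) ^ 2 - Real.sin α * Real.sin (9 * α) := by
    have : Real.sin (3 * α) ^ 2 - Real.sin α * Real.sin (9 * α) =
        32 * (Real.sin α ^ 2) ^ 2 * (3 - 4 * Real.sin α ^ 2) * (1 - 2 * Real.sin α ^ 2) *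
          (1 - Real.sin α ^ 2) := by
      rw [f₂, f₁]; ring
    rw [this]
    have h1 : 0 < 3 - 4 * Real.sin α ^ 2 := by linarith
    have h2 : 0 < 1 - 2 * Real.sin α ^ 2 := by linarith
    have h3 : 0 < 1 - Real.sin α ^ 2 := by linarith
    positivity
  obtain ⟨y, ν, a, b, hν, h1, h2, h3, h4⟩ := exists_symmetric_solution hc₀ hc₁ hs₀ hs₁ hs₂ hD hR
  set β : ℂ := Complex.exp (α * Complex.I) with hβ
  have hβ0 : β ≠ 0 := Complex.exp_ne_zero _
  have hβstar : (starRingEnd ℂ) β = β⁻¹ := by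
    rw [hβ, ← Complex.exp_conj, ← Complex.exp_neg]
    simp
  have hω : rootOfUnity d = β ^ 4 := by
    rw [rootOfUnity, hβ, ← Complex.exp_nat_mul, hα]
    congr 1
    have : (d : ℂ) ≠ 0 := by exact_mod_cast (by omega : d ≠ 0)
    push_cast
    field_simp
    ring
  have hpow : ∀ n : ℕ, β ^ n =
      (Real.cos (n * α) : ℂ) + (Real.sin (n * α) : ℂ) * Complex.I := by
    intro n
    rw [hβ, ← Complex.exp_nat_mul, ← mul_assoc, Complex.exp_mul_I]
    push_cast
    rfl
  have hpow' : ∀ n : ℕ, β⁻¹ ^ n =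
      (Real.cos (n * α) : ℂ) - (Real.sin (n * α) : ℂ) * Complex.I := by
    intro n
    rw [← hβstar, ← map_pow, hpow]
    rw [map_add, map_mul, Complex.conj_ofReal, Complex.conj_ofReal, Complex.conj_I]
    ring
  let μ : ℂ := a + b * Complex.I
  let μ' : ℂ := a - b * Complex.I
  have hμ : (starRingEnd ℂ) μ = μ' := by
    simp only [μ, μ', map_add, map_mul, Complex.conj_ofReal, Complex.conj_I]
    ring
  have hI := Complex.I_sq
  have E₁ : β ^ 9 * (1 + ν * ν) + β ^ 3 * (y + μ' * ν) + β⁻¹ ^ 3 * (y - μ' * ν) +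
      β⁻¹ ^ 9 * (1 - ν * ν) = 0 := by
    have h1' : (Real.cos (9 * α) + y * Real.cos (3 * α) + b * ν * Real.sin (3 * α) : ℂ) = 0 := by
      exact_mod_cast h1
    have h2' : (ν * Real.sin (9 * α) + a * Real.sin (3 * α) : ℂ) = 0 := by exact_mod_cast h2
    rw [hpow, hpow, hpow', hpow']
    simp only [Nat.cast_ofNat, μ']
    linear_combination 2 * h1' + 2 * ν * Complex.I * h2' - 2 * b * ν * Real.sin (3 * α) * hI
  have E₂ : β ^ 3 * (y + ν * μ) + β * (y * y + μ' * μ) + β⁻¹ * (y * y - μ' * μ) +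
      β⁻¹ ^ 3 * (y - ν * μ) = 0 := by
    have h3' : (y ^ 2 * Real.cos α + y * Real.cos (3 * α) - b * ν * Real.sin (3 * α) : ℂ) = 0 := by
      exact_mod_cast h3
    have h4' : ((a ^ 2 + b ^ 2) * Real.sin α + a * ν * Real.sin (3 * α) : ℂ) = 0 := by
      exact_mod_cast h4
    have hp := hpow 1
    have hp' := hpow' 1
    simp only [pow_one, Nat.cast_one, one_mul] at hp hp'
    rw [hpow, hpow', hp', hp]
    simp only [Nat.cast_ofNat, μ, μ']
    linear_combination 2 * h3' + 2 * Complex.I * h4' +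
      (2 * b * ν * Real.sin (3 * α) - 2 * b ^ 2 * Real.sin α * Complex.I) * hI
  refine exists_entangled_of_family (by omega)
    (fun n => match n with
      | 0 => ![1, -ν]
      | 1 => ![β ^ 6 * y, β ^ 6 * -μ]
      | 2 => ![β ^ 12 * y, β ^ 12 * μ]
      | 3 => ![β ^ 18, β ^ 18 * ν]
      | _ => 0) ?_ ?_ ?_
  · intro n hn
    match n, hn with
    | n + 4, _ => rfl
  · intro i hi
    rw [hω]
    interval_cases i <;>
      simp only [Finset.sum_range_succ, Finset.sum_range_zero, zero_add, Fin.sum_univ_two, RCLike.star_def,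
        Matrix.cons_val_zero, Matrix.cons_val_one, map_mul, map_neg, map_pow, map_one,
        Complex.conj_ofReal, hβstar, hμ]
    · rw [← mul_zero (β⁻¹ ^ 9), ← E₁]
      field_simp
      ring
    · rw [← mul_zero (β ^ 3), ← E₂]
      field_simp
      ring
    · rw [← mul_zero (β ^ 15), ← E₂]
      field_simp
      ring
    · rw [← mul_zero (β ^ 27), ← E₁]
      field_simp
      ring
  · have hν' : (ν : ℂ) ≠ 0 := by exact_mod_cast hν
    simp only [Matrix.cons_val_zero, Matrix.cons_val_one]
    intro h
    have h5 : 2 * (β ^ 18 * ν) = 0 := by linear_combination h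
    simp [hβ0, hν'] at h5

end QMeas

theorem mainTheorem7 (d : ℕ) (hd : 4 ≤ d) :
    QMeas.PerfectlyDistinguishable
        (QMeas.measurement (QMeas.fourier d)) (QMeas.measurement 1) ∧
    (∃ ψ : Fin d × Fin 2 → ℂ,
        star ψ ⬝ᵥ ψ = 1 ∧
        ¬ QMeas.IsSeparable (QMeas.ketbra ψ) ∧
        QMeas.DiscriminatedBy
          (QMeas.measurement (QMeas.fourier d)) (QMeas.measurement 1) (QMeas.ketbra ψ)) ∧
    (∀ m n : ℕ, 1 < m → d = m ^ 2 * n →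
        QMeas.DistinguishableWithoutAncilla
          (QMeas.measurement (QMeas.fourier d)) (QMeas.measurement 1)) ∧
    (d.Prime →
        ¬ QMeas.DistinguishableWithoutAncilla
          (QMeas.measurement (QMeas.fourier d)) (QMeas.measurement 1) ∧
        ∀ (k : ℕ) (σ : Matrix (Fin d × Fin k) (Fin d × Fin k) ℂ), QMeas.IsSeparable σ →
          ¬ QMeas.DiscriminatedBy
            (QMeas.measurement (QMeas.fourier d)) (QMeas.measurement 1) σ) := by
  have hent : ∃ ψ : Fin d × Fin 2 → ℂ, star ψ ⬝ᵥ ψ = 1 ∧ ¬ QMeas.IsSeparable (QMeas.ketbra ψ) ∧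
      QMeas.DiscriminatedBy
        (QMeas.measurement (QMeas.fourier d)) (QMeas.measurement 1) (QMeas.ketbra ψ) := by
    rcases hd.eq_or_lt with rfl | h
    · exact QMeas.exists_entangled_four
    · exact QMeas.exists_entangled_of_five_le h
  have hprime : d.Prime → ∀ ρ : Matrix (Fin d) (Fin d) ℂ, QMeas.IsState ρ →
      QMeas.measurement (QMeas.fourier d) ρ * QMeas.measurement 1 ρ ≠ 0 := by
    intro hp ρ hρ h
    obtain ⟨v, hv, hv'⟩ := QMeas.exists_ne_zero_of_measurement_mul_eq_zero _ hρ h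
    exact hv (QMeas.eq_zero_of_eq_zero_or_sum_fourier_eq_zero hp v hv')
  refine ⟨?_, hent, fun m n hm h => QMeas.distinguishableWithoutAncilla_fourier (by omega) hm h,
    fun hp => ⟨?_, ?_⟩⟩
  · obtain ⟨ψ, hψ, -, h⟩ := hent
    exact ⟨2, _, QMeas.isState_ketbra hψ, h⟩
  · rintro ⟨ρ, hρ, h⟩
    exact hprime hp ρ hρ (h.mul_eq_zero (hρ.measurement _) (hρ.measurement _))
  · intro k σ hσ h
    obtain ⟨ρ, hρ, h0⟩ := hσ.exists_measurement_mul_eq_zero h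
    exact hprime hp ρ hρ h0
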